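/- Let $G$ be a finitely generated group and let $\rho$ be a cocompact action of $G$, by simplicial automorphisms and without inversions, on an infinite, locally finite simplicial tree $T$. Suppose that there exist an infinite simplicial tree $\tilde T$ (not necessarily locally finite), a minimal action of $G$ on $\tilde T$ by simplicial automorphisms without inversions, and a $G$-equivariant morphism of trees $q:\tilde T\to T$ which is locally surjective but not locally injective. Then for every point $z$ of $T$ (a vertex or a point in the interior of an edge), the stabilizer $G_z=\{g\in G : \rho(g)z=z\}$ is not finitely generated. Here an action on a tree is minimal if there is no proper invariant (nonempty) subtree; a morphism of trees sends vertices to vertices and edges to edges and preserves adjacency; it is locally surjective (resp. locally injective) if for each vertex $v$ of the domain it maps the set of edges at $v$ onto (resp. injectively into) the set of edges at the image of $v$. -/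

import Mathlib

namespace TreeAction

/-- The geometric realization `|T|` of a graph, in barycentric coordinates: a point is a formal convex
combination of the two ends of an edge, or a vertex (the case `u = v`). -/
def Realization {V : Type*} (T : SimpleGraph V) : Type _ :=
  {x : V →₀ ℝ // ∃ u v : V, (u = v ∨ T.Adj u v) ∧
    x ∈ segment ℝ (Finsupp.single u (1 : ℝ)) (Finsupp.single v (1 : ℝ))}

/-- Simplicial automorphisms of `T` act on `|T|`: vertices are moved by the automorphism, and the action
is extended affinely over edges. -/
noncomputable instance {V : Type*} (T : SimpleGraph V) : MulAction (T ≃g T) (Realization T) where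
  smul f x := ⟨Finsupp.mapDomain f x.1, by
    obtain ⟨u, v, huv, a, b, ha, hb, hab, hx⟩ := x.2
    refine ⟨f u, f v, huv.imp (fun h => by rw [h]) (fun h => f.map_adj_iff.2 h),
      a, b, ha, hb, hab, ?_⟩
    rw [← hx]
    simp [Finsupp.mapDomain_add, Finsupp.mapDomain_single]⟩
  one_smul x := Subtype.ext (Finsupp.mapDomain_id (v := x.1))
  mul_smul f g x := Subtype.ext (Finsupp.mapDomain_comp (v := x.1) (f := g) (g := f))

/-- The stabilizer `G_z` of a point `z` of `|T|` under an action `ρ` of `G` on `T`. -/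
noncomputable def pointStabilizer {G V : Type*} [Group G] {T : SimpleGraph V}
    (ρ : G →* (T ≃g T)) (z : Realization T) : Subgroup G :=
  (MulAction.stabilizer (T ≃g T) z).comap ρ

/-- `T`, with the simplicial action `ρ`, is a `G`-tree: an infinite simplicial tree on which `G` acts
without inversions. -/
structure IsGTree {G V : Type*} [Group G] (T : SimpleGraph V) (ρ : G →* (T ≃g T)) : Prop where
  isTree : T.IsTree
  infinite : Infinite V
  no_inversion : ∀ (g : G) (u v : V), T.Adj u v → ¬ (ρ g u = v ∧ ρ g v = u)

/-- Every vertex has a finite star. -/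
def IsLocallyFinite {V : Type*} (T : SimpleGraph V) : Prop :=
  ∀ v : V, (T.incidenceSet v).Finite

/-- The action is cocompact: the translates of some finite subgraph cover the graph. -/
def IsCocompact {G V : Type*} [Group G] {T : SimpleGraph V} (ρ : G →* (T ≃g T)) : Prop :=
  ∃ K : T.Subgraph, K.verts.Finite ∧
    (∀ v : V, ∃ g : G, ρ g v ∈ K.verts) ∧
    (∀ u v : V, T.Adj u v → ∃ g : G, K.Adj (ρ g u) (ρ g v))

/-- A subgraph is invariant under the action. -/
def IsInvariant {G V : Type*} [Group G] {T : SimpleGraph V} (ρ : G →* (T ≃g T))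
    (S : T.Subgraph) : Prop :=
  (∀ (g : G) (v : V), v ∈ S.verts → ρ g v ∈ S.verts) ∧
    (∀ (g : G) (u v : V), S.Adj u v → S.Adj (ρ g u) (ρ g v))

/-- The action on a tree is minimal: there is no proper invariant subtree. The subtrees of a tree are its
(nonempty) connected subgraphs. -/
def IsMinimal {G V : Type*} [Group G] {T : SimpleGraph V} (ρ : G →* (T ≃g T)) : Prop :=
  ∀ S : T.Subgraph, S.Connected → IsInvariant ρ S → S = ⊤

/-- A morphism is locally surjective if it maps the star of each vertex `v` onto the star of `q v`. -/
def LocallySurjective {V W : Type*} {T : SimpleGraph V} {T' : SimpleGraph W} (q : T →g T') : Prop :=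
  ∀ v : V, Set.SurjOn (Sym2.map q) (T.incidenceSet v) (T'.incidenceSet (q v))

/-- A morphism is locally injective if it is injective on the star of each vertex. -/
def LocallyInjective {V W : Type*} {T : SimpleGraph V} {T' : SimpleGraph W} (q : T →g T') : Prop :=
  ∀ v : V, Set.InjOn (Sym2.map q) (T.incidenceSet v)

/-- The morphism is `G`-equivariant. -/
def IsEquivariant {G V W : Type*} [Group G] {T : SimpleGraph V} {T' : SimpleGraph W}
    (ρ : G →* (T ≃g T)) (ρ' : G →* (T' ≃g T')) (q : T →g T') : Prop :=
  ∀ (g : G) (v : V), q (ρ g v) = ρ' g (q v)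

/-- The conditions on an action `ρ` of `G` on `T`, relative to a second tree `T'` (with action `ρ'`) and a
map `q` from `T'` to `T`: `G` is finitely generated, `T` is a locally finite cocompact `G`-tree,
`T'` is a minimal `G`-tree, not assumed to be locally finite, and `q` is a `G`-morphism which is locally
surjective but not locally injective. -/
structure CollapsingConditions {G V W : Type*} [Group G] {T : SimpleGraph V} {T' : SimpleGraph W}
    (ρ : G →* (T ≃g T)) (ρ' : G →* (T' ≃g T')) (q : T' →g T) : Prop where
  fg : Group.FG G
  isGTree : IsGTree T ρ
  locallyFinite : IsLocallyFinite T
  cocompact : IsCocompact ρ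
  isGTree' : IsGTree T' ρ'
  minimal' : IsMinimal ρ'
  equivariant : IsEquivariant ρ' ρ q
  locallySurjective : LocallySurjective q
  not_locallyInjective : ¬ LocallyInjective q

end TreeAction

/-! Finite generation of `G_z` would make the fibre of `q` over a vertex `z` coarsely connected, and
folds far from `z` prevent this. A minimal action of a finitely generated group has finitely many
vertex orbits, so by equivariance `G_z` has finitely many orbits on the fibre. If `G_z` is finitely
generated, finitely many walks then join the whole fibre over some ball about `z`
(`exists_joined_of_fg`). Conversely, let two edges at `u` have the same image, pointing towards `z`.
Lifting the path to `z` along each of them gives two points of the fibre separated by `u`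
(`exists_not_joined_of_fold`). It remains to move `q u` out of any ball about `z` while the image
edge still points to `z`. Cocompactness allows this if the half-tree ahead is infinite
(`IsTree.exists_mem_half_of_infinite`), and since the upper tree has no leaves, such a fold exists
(`exists_fold_infinite_half`). Interior points of edges reduce to vertices, as edge stabilizers have
finite index in vertex stabilizers (`fg_vertexStabilizer_of_fg_inf`). -/

namespace SimpleGraph

variable {V : Type*} {T : SimpleGraph V}

/-! ### Distances and half-trees -/

/-- In a tree, a vertex other than `x` has only one neighbour closer to `x`. -/
theorem IsTree.eq_of_adj_of_dist (hT : T.IsTree) {x v a b : V} (ha : T.Adj v a) (hb : T.Adj v b)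
    (hda : T.dist x v = T.dist x a + 1) (hdb : T.dist x v = T.dist x b + 1) : a = b := by
  obtain ⟨p, hp⟩ := hT.connected.exists_walk_length_eq_dist a x
  obtain ⟨r, hr⟩ := hT.connected.exists_walk_length_eq_dist b x
  have hp' : (Walk.cons ha p).IsPath := Walk.isPath_of_length_eq_dist _ (by
    rw [Walk.length_cons, hp, dist_comm, ← hda, dist_comm])
  have hr' : (Walk.cons hb r).IsPath := Walk.isPath_of_length_eq_dist _ (by
    rw [Walk.length_cons, hr, dist_comm, ← hdb, dist_comm])
  have := (hT.existsUnique_path v x).unique hp' hr'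
  have h := congrArg (fun w => w.getVert 1) this
  simpa using h

/-- Every vertex different from `x` has a neighbour closer to `x`. -/
theorem Connected.exists_adj_dist_eq (hT : T.Connected) {x v : V} (h : v ≠ x) :
    ∃ a, T.Adj v a ∧ T.dist x v = T.dist x a + 1 := by
  obtain ⟨p, hp⟩ := hT.exists_walk_length_eq_dist v x
  cases p with
  | nil => exact absurd rfl h
  | cons hadj p =>
    rename_i a
    refine ⟨a, hadj, ?_⟩
    rw [Walk.length_cons] at hp
    have h1 := dist_le p
    have h2 := hT.dist_triangle (u := v) (v := a) (w := x)
    have h3 : T.dist v a = 1 := dist_eq_one_iff_adj.2 hadj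
    rw [dist_comm (u := x), dist_comm (u := x)]
    omega

/-- Two distinct neighbours of a vertex `u` of a tree are only joined through `u`. -/
theorem IsTree.mem_support_of_adj (hT : T.IsTree) {u a b : V} (ha : T.Adj u a) (hb : T.Adj u b)
    (hab : a ≠ b) (p : T.Walk a b) : u ∈ p.support := by
  classical
  have hr : (Walk.cons ha.symm (Walk.cons hb Walk.nil)).IsPath := by
    simp [Walk.cons_isPath_iff, ha.ne', hb.ne, hab]
  have := (hT.existsUnique_path a b).unique p.bypass_isPath hr
  apply p.support_bypass_subset_support
  rw [this]
  simp

/-- The half-tree at the end `b` of an edge from `a` to `b`. -/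
def half (T : SimpleGraph V) (a b : V) : Set V :=
  {x | T.dist x a = T.dist x b + 1}

theorem mem_half {a b x : V} : x ∈ T.half a b ↔ T.dist x a = T.dist x b + 1 := Iff.rfl

theorem left_notMem_half {a b : V} : a ∉ T.half a b := by
  simp [mem_half]

theorem IsTree.notMem_half_iff (hT : T.IsTree) {a b : V} (hab : T.Adj a b) {x : V} :
    x ∉ T.half a b ↔ T.dist x b = T.dist x a + 1 := by
  rw [mem_half]
  have := hT.dist_eq_dist_add_one_of_adj x hab
  omega

/-- The only edge from the complement of a half-tree into it is the defining one. -/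
theorem IsTree.eq_of_adj_of_mem_half (hT : T.IsTree) {a b u v : V} (hab : T.Adj a b)
    (huv : T.Adj u v) (hu : u ∉ T.half a b) (hv : v ∈ T.half a b) : u = a ∧ v = b := by
  rw [hT.notMem_half_iff hab] at hu
  rw [mem_half] at hv
  have h1 := hT.dist_eq_dist_add_one_of_adj a huv
  have h2 := hT.dist_eq_dist_add_one_of_adj b huv
  rw [dist_comm, dist_comm (u := a) (v := v)] at h1
  rw [dist_comm, dist_comm (u := b) (v := v)] at h2
  by_cases hua : u = a
  · subst hua
    refine ⟨rfl, ?_⟩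
    rw [dist_self] at h1 hu
    exact (hT.connected.dist_eq_zero_iff).1 (by omega)
  -- The neighbour `w` of `u` towards `a` is also closer to `b`, as is `v`. So `w = v`, which puts
  -- `v` on the side of `a`.
  · obtain ⟨w, hw, hwd⟩ := hT.connected.exists_adj_dist_eq hua
    rw [dist_comm, dist_comm (u := a) (v := w)] at hwd
    have h3 := hT.dist_eq_dist_add_one_of_adj b hw
    have h4 := hT.dist_eq_dist_add_one_of_adj w hab
    have h5 := dist_comm (G := T) (u := b) (v := w)
    have h6 := dist_comm (G := T) (u := b) (v := u)
    have h7 := dist_comm (G := T) (u := b) (v := v)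
    have : w = v := hT.eq_of_adj_of_dist (x := b) hw huv (by omega) (by omega)
    subst this
    omega

/-- A walk entering the half-tree must traverse the edge from `a` to `b`; the `1` counts this edge.
-/
theorem IsTree.dist_add_dist_le_length (hT : T.IsTree) {a b : V} (hab : T.Adj a b) {x y : V}
    (p : T.Walk y x) (hy : y ∉ T.half a b) (hx : x ∈ T.half a b) :
    T.dist y a + 1 + T.dist b x ≤ p.length := by
  induction p with
  | nil => exact absurd hx hy
  | cons huv p ih =>
    rename_i u v w
    rw [Walk.length_cons]
    by_cases hv : v ∈ T.half a b
    · obtain ⟨rfl, rfl⟩ := hT.eq_of_adj_of_mem_half hab huv hy hv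
      have := dist_le p
      rw [dist_self]
      omega
    · have := ih hv hx
      have h2 := hT.connected.dist_triangle (u := u) (v := v) (w := a)
      have h3 : T.dist u v = 1 := dist_eq_one_iff_adj.2 huv
      omega

/-- A half-tree is separated from its complement by the initial vertex of its defining edge. -/
theorem IsTree.dist_eq_of_half (hT : T.IsTree) {a b : V} (hab : T.Adj a b) {x y : V}
    (hy : y ∉ T.half a b) (hx : x ∈ T.half a b) : T.dist y x = T.dist y a + T.dist a x := by
  obtain ⟨p, hp⟩ := hT.connected.exists_walk_length_eq_dist y x
  have h1 := hT.dist_add_dist_le_length hab p hy hx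
  have h2 := hT.connected.dist_triangle (u := y) (v := a) (w := x)
  rw [mem_half, dist_comm, dist_comm (v := b)] at hx
  omega

theorem dist_iso (f : T ≃g T) (x y : V) : T.dist (f x) (f y) = T.dist x y := by
  have key : ∀ (f : T ≃g T) (x y : V), T.Reachable x y → T.dist (f x) (f y) ≤ T.dist x y := by
    intro f x y h
    obtain ⟨p, hp⟩ := h.exists_walk_length_eq_dist
    rw [← hp, ← Walk.length_map f.toHom p]
    exact dist_le _
  by_cases h : T.Reachable x y
  · apply le_antisymm (key f x y h)
    have := key f.symm (f x) (f y) (h.map f.toHom)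
    simpa using this
  · rw [dist_eq_zero_of_not_reachable h, dist_eq_zero_of_not_reachable]
    intro h'
    exact h (by simpa using h'.map f.symm.toHom)

theorem mem_half_iso (f : T ≃g T) {a b x : V} : f x ∈ T.half (f a) (f b) ↔ x ∈ T.half a b := by
  simp only [mem_half, dist_iso]

/-! ### Local finiteness and translates of an edge -/

/-- Balls of a connected locally finite graph are finite. -/
theorem Connected.finite_setOf_dist_le (hT : T.Connected) (hf : ∀ v, (T.neighborSet v).Finite)
    (a : V) (n : ℕ) : {x | T.dist a x ≤ n}.Finite := by
  induction n with
  | zero =>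
    refine (Set.finite_singleton a).subset fun x hx => ?_
    exact ((hT.dist_eq_zero_iff).1 (Nat.le_zero.1 hx)).symm
  | succ n ih =>
    refine (ih.union (ih.biUnion fun v _ => hf v)).subset fun x hx => ?_
    by_cases hxa : x = a
    · left; simp [hxa]
    · obtain ⟨w, hw, hd⟩ := hT.exists_adj_dist_eq hxa
      right
      change T.dist a x ≤ n + 1 at hx
      exact Set.mem_biUnion (show T.dist a w ≤ n by omega) hw.symm

/-- An infinite set of vertices of a connected locally finite graph is unbounded. -/
theorem Connected.exists_lt_dist_of_infinite (hT : T.Connected)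
    (hf : ∀ v, (T.neighborSet v).Finite) {S : Set V} (hS : S.Infinite) (a : V) (n : ℕ) :
    ∃ x ∈ S, n < T.dist a x := by
  by_contra! h
  exact hS ((hT.finite_setOf_dist_le hf a n).subset h)

/-- If the half-tree of an edge is infinite, then some edge in the orbit of this edge is far away from
`z` and points to `z`. -/
theorem IsTree.exists_mem_half_of_infinite {G : Type*} [Group G] (hT : T.IsTree)
    (hf : ∀ v, (T.neighborSet v).Finite) (ρ : G →* (T ≃g T)) {a b : V} (hab : T.Adj a b)
    (hinf : (T.half a b).Infinite) {D : ℕ} (hD : ∀ x, ∃ g, T.dist x (ρ g a) ≤ D) (z : V) (R : ℕ) :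
    ∃ g, R < T.dist z (ρ g a) ∧ z ∈ T.half (ρ g a) (ρ g b) := by
  by_contra! hcon
  have hc := hT.connected
  obtain ⟨x, -, hx⟩ := hc.exists_lt_dist_of_infinite hf hinf z (R + D)
  obtain ⟨g₀, hg₀⟩ := hD x
  have hadj : ∀ g, T.Adj (ρ g a) (ρ g b) := fun g => (ρ g).map_adj_iff.2 hab
  have hz₀ : z ∉ T.half (ρ g₀ a) (ρ g₀ b) := hcon g₀ (by
    have := hc.dist_triangle (u := z) (v := ρ g₀ a) (w := x)
    rw [dist_comm] at hg₀
    omega)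
  have hinf₀ : (T.half (ρ g₀ a) (ρ g₀ b)).Infinite := by
    refine (hinf.image (ρ g₀).injective.injOn).mono ?_
    rintro _ ⟨y, hy, rfl⟩
    exact (mem_half_iso _).2 hy
  -- A translate whose tail is within `D` of a point this deep has its tail inside the half-tree and
  -- still far from `z`, so it too points away from `z`.
  obtain ⟨x', hx', hxd⟩ := hc.exists_lt_dist_of_infinite hf hinf₀ (ρ g₀ a) (R + D)
  obtain ⟨g₁, hg₁⟩ := hD x'
  have hmem : ρ g₁ a ∈ T.half (ρ g₀ a) (ρ g₀ b) := by
    by_contra hn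
    have := hT.dist_eq_of_half (hadj g₀) hn hx'
    rw [dist_comm] at hg₁
    omega
  have hz₁ : z ∉ T.half (ρ g₁ a) (ρ g₁ b) := hcon g₁ (by
    have h1 := hT.dist_eq_of_half (hadj g₀) hz₀ hmem
    have h2 := hc.dist_triangle (u := ρ g₀ a) (v := ρ g₁ a) (w := x')
    rw [dist_comm] at hg₁
    omega)
  obtain ⟨g, rfl⟩ : ∃ g, g₁ = g * g₀ := ⟨g₁ * g₀⁻¹, by simp⟩
  simp only [map_mul, RelIso.mul_apply] at hmem hz₁
  have hadj₀ := hadj g₀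
  have hne : T.dist (ρ g₀ a) (ρ g (ρ g₀ a)) ≠ 0 := by
    intro h0
    rw [hc.dist_eq_zero_iff] at h0
    rw [← h0] at hmem
    exact left_notMem_half hmem
  have hcon₀ : ∀ k, R < T.dist z (ρ k (ρ g₀ a)) → z ∉ T.half (ρ k (ρ g₀ a)) (ρ k (ρ g₀ b)) := by
    intro k hk
    have := hcon (k * g₀)
    simp only [map_mul, RelIso.mul_apply] at this
    exact this hk
  generalize ρ g₀ a = a₀ at *
  generalize ρ g₀ b = b₀ at *
  have hadj₁ : T.Adj (ρ g a₀) (ρ g b₀) := (ρ g).map_adj_iff.2 hadj₀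
  have ha₀ : a₀ ∉ T.half (ρ g a₀) (ρ g b₀) := by
    intro h
    have h1 := hT.dist_eq_of_half hadj₁ hz₁ h
    have h2 := hT.dist_eq_of_half hadj₀ hz₀ hmem
    have := dist_comm (G := T) (u := a₀) (v := ρ g a₀)
    omega
  -- Since `g` maps the half-tree into itself, its powers push `a₀` ever deeper. Negative powers
  -- will move the edge far back, with `a₀`, and then `z`, ahead of it.
  have hsub : ∀ y, y ∈ T.half (ρ g a₀) (ρ g b₀) → y ∈ T.half a₀ b₀ := by
    intro y hy
    by_contra hn
    have h1 := hT.dist_eq_of_half hadj₀ hn hmem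
    have h2 := hT.dist_eq_of_half hadj₁ ha₀ hy
    have h3 := dist_comm (G := T) (u := y) (v := ρ g a₀)
    have h4 := dist_comm (G := T) (u := y) (v := a₀)
    omega
  have hpow : ∀ n : ℕ, ρ (g ^ (n + 1)) a₀ ∈ T.half a₀ b₀ ∧
      n + 1 ≤ T.dist a₀ (ρ (g ^ (n + 1)) a₀) := by
    intro n
    induction n with
    | zero => exact ⟨by simpa using hmem, by simp only [zero_add, pow_one]; omega⟩
    | succ n ih =>
      rw [pow_succ' g (n + 1), map_mul, RelIso.mul_apply]
      have hin := (mem_half_iso (ρ g)).2 ih.1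
      refine ⟨hsub _ hin, ?_⟩
      rw [hT.dist_eq_of_half hadj₁ ha₀ hin, dist_iso]
      omega
  obtain ⟨n, hn⟩ : ∃ n, n = T.dist z a₀ + R := ⟨_, rfl⟩
  obtain ⟨hp₁, hp₂⟩ := hpow n
  have hinv : ∀ y, ρ (g ^ (n + 1))⁻¹ (ρ (g ^ (n + 1)) y) = y := fun y => by
    rw [← RelIso.mul_apply, ← map_mul]; simp
  set k := (g ^ (n + 1))⁻¹ with hk
  have hd : T.dist a₀ (ρ (g ^ (n + 1)) a₀) = T.dist (ρ k a₀) a₀ := by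
    rw [← dist_iso (ρ k), hinv]
  have hm : a₀ ∈ T.half (ρ k a₀) (ρ k b₀) := by
    rw [← hinv a₀, mem_half_iso, hinv]
    exact hp₁
  have hfar : R < T.dist z (ρ k a₀) := by
    have h1 := hc.dist_triangle (u := ρ k a₀) (v := z) (w := a₀)
    have h2 := dist_comm (G := T) (u := ρ k a₀) (v := z)
    omega
  have h3 := hT.dist_eq_of_half ((ρ k).map_adj_iff.2 hadj₀) (hcon₀ k hfar) hm
  omega

end SimpleGraph

namespace TreeAction

open SimpleGraph

variable {G V W : Type*} [Group G] {T : SimpleGraph V} {T' : SimpleGraph W}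

/-! ### Walks confined to a set of vertices -/

/-- `x` and `y` are joined by a walk in `U`. -/
def Joined (T : SimpleGraph V) (U : Set V) (x y : V) : Prop :=
  ∃ p : T.Walk x y, ∀ v ∈ p.support, v ∈ U

theorem Joined.symm {U : Set V} {x y : V} (h : Joined T U x y) : Joined T U y x := by
  obtain ⟨p, hp⟩ := h
  exact ⟨p.reverse, by simpa using hp⟩

theorem Joined.trans {U : Set V} {x y z : V} (h : Joined T U x y) (h' : Joined T U y z) :
    Joined T U x z := by
  obtain ⟨p, hp⟩ := h
  obtain ⟨r, hr⟩ := h'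
  exact ⟨p.append r, fun v hv => (p.mem_support_append_iff r).1 hv |>.elim (hp v) (hr v)⟩

theorem Joined.refl {U : Set V} {x : V} (h : x ∈ U) : Joined T U x x :=
  ⟨Walk.nil, by simpa using h⟩

theorem Joined.of_adj {U : Set V} {x y : V} (h : T.Adj x y) (hx : x ∈ U) (hy : y ∈ U) :
    Joined T U x y :=
  ⟨h.toWalk, by simp [Adj.toWalk, hx, hy]⟩

theorem Joined.mono {U U' : Set V} {x y : V} (h : Joined T U x y) (hU : U ⊆ U') :
    Joined T U' x y := by
  obtain ⟨p, hp⟩ := h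
  exact ⟨p, fun v hv => hU (hp v hv)⟩

theorem Joined.map {U : Set V} {x y : V} (h : Joined T U x y) (f : T ≃g T)
    (hf : ∀ v ∈ U, f v ∈ U) : Joined T U (f x) (f y) := by
  obtain ⟨p, hp⟩ := h
  refine ⟨p.map f.toHom, fun v hv => ?_⟩
  rw [Walk.support_map, List.mem_map] at hv
  obtain ⟨w, hw, rfl⟩ := hv
  exact hf w (hp w hw)

theorem inv_apply_apply (ρ : G →* (T ≃g T)) (g : G) (v : V) : ρ g⁻¹ (ρ g v) = v := by
  rw [← RelIso.mul_apply, ← map_mul]; simp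

theorem apply_inv_apply (ρ : G →* (T ≃g T)) (g : G) (v : V) : ρ g (ρ g⁻¹ v) = v := by
  rw [← RelIso.mul_apply, ← map_mul]; simp

/-- If generators of a subgroup move `x` inside its component of an invariant set `U`, then so do all
elements. -/
theorem joined_of_mem_closure (ρ : G →* (T ≃g T)) {S : Set G} {U : Set V} {x : V} (hx : x ∈ U)
    (hU : ∀ g ∈ Subgroup.closure S, ∀ v ∈ U, ρ g v ∈ U) (hS : ∀ s ∈ S, Joined T U x (ρ s x))
    {g : G} (hg : g ∈ Subgroup.closure S) : Joined T U x (ρ g x) := by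
  induction hg using Subgroup.closure_induction with
  | mem s hs => exact hS s hs
  | one => simpa using Joined.refl hx
  | mul g k hg _ ihg ihk =>
    rw [map_mul, RelIso.mul_apply]
    exact ihg.trans (ihk.map _ (hU g hg))
  | inv g hg ih =>
    have := ih.map (ρ g⁻¹) (hU _ (inv_mem hg))
    rw [inv_apply_apply] at this
    exact this.symm

/-! ### Consequences of minimality and cocompactness -/

/-- A nonempty invariant set of vertices that spans a connected subgraph contains all vertices, if the
action is minimal. -/
theorem IsMinimal.eq_univ {ρ : G →* (T ≃g T)} (h : IsMinimal ρ) {U : Set V} (hne : U.Nonempty)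
    (hU : ∀ g, ∀ v ∈ U, ρ g v ∈ U) (hc : ∀ x ∈ U, ∀ y ∈ U, Joined T U x y) : U = Set.univ := by
  have := h ((⊤ : T.Subgraph).induce U) ?_ ?_
  · have h2 := congrArg Subgraph.verts this
    simpa using h2
  · rw [Subgraph.connected_iff_forall_exists_walk_subgraph]
    refine ⟨hne, fun {x y} hx hy => ?_⟩
    obtain ⟨p, hp⟩ := hc x hx y hy
    exact ⟨p, p.toSubgraph_le_induce_support.trans (Subgraph.induce_mono_right hp)⟩
  · refine ⟨fun g v hv => hU g v hv, fun g u v huv => ?_⟩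
    simp only [Subgraph.induce_adj, Subgraph.top_adj] at huv ⊢
    exact ⟨hU g u huv.1, hU g v huv.2.1, (ρ g).map_adj_iff.2 huv.2.2⟩

/-- A minimal action of a finitely generated group on a connected graph has finitely many orbits of
vertices. -/
theorem IsMinimal.exists_finite {ρ : G →* (T ≃g T)} (h : IsMinimal ρ) (hG : Group.FG G)
    (hT : T.Connected) : ∃ F : Set V, F.Finite ∧ ∀ v, ∃ g, ∃ f ∈ F, ρ g f = v := by
  obtain ⟨S, hS⟩ := Group.fg_def.1 hG
  obtain ⟨x⟩ := hT.nonempty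
  let p : ∀ g, T.Walk x (ρ g x) := fun g => (hT.preconnected x (ρ g x)).some
  let F : Set V := {x} ∪ ⋃ s ∈ S, {v | v ∈ (p s).support}
  have hxF : x ∈ F := Or.inl rfl
  have hFS : ∀ s ∈ S, ∀ v ∈ (p s).support, v ∈ F := fun s hs v hv =>
    Or.inr (Set.mem_biUnion (Finset.mem_coe.2 hs) hv)
  -- The saturation of `F` is connected because `F` contains walks from `x` to its translates by the
  -- generators.
  let U : Set V := {v | ∃ g, ∃ f ∈ F, ρ g f = v}
  have hFU : F ⊆ U := fun f hf => ⟨1, f, hf, by simp⟩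
  have hU : ∀ g, ∀ v ∈ U, ρ g v ∈ U := by
    rintro g _ ⟨k, f, hf, rfl⟩
    exact ⟨g * k, f, hf, by simp⟩
  have hgx : ∀ g, Joined T U x (ρ g x) := fun g =>
    joined_of_mem_closure (S := (S : Set G)) ρ (hFU hxF) (fun g _ => hU g)
      (fun s hs => ⟨p s, fun v hv => hFU (hFS s hs v hv)⟩) (hS ▸ Subgroup.mem_top g)
  have hxf : ∀ f ∈ F, Joined T U x f := by
    classical
    rintro f (rfl | hf)
    · exact Joined.refl (hFU hxF)
    · simp only [Set.mem_iUnion] at hf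
      obtain ⟨s, hs, hf⟩ := hf
      exact ⟨(p s).takeUntil f hf, fun v hv =>
        hFU (hFS s hs v ((p s).support_takeUntil_subset_support hf hv))⟩
  have hxU : ∀ v ∈ U, Joined T U x v := by
    rintro _ ⟨g, f, hf, rfl⟩
    exact (hgx g).trans ((hxf f hf).map _ (hU g))
  have := h.eq_univ ⟨x, hFU hxF⟩ hU fun y hy y' hy' => (hxU y hy).symm.trans (hxU y' hy')
  refine ⟨F, (Set.finite_singleton x).union (S.finite_toSet.biUnion fun s _ =>
    List.finite_toSet _), fun v => ?_⟩
  have hv : v ∈ U := this ▸ Set.mem_univ v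
  exact hv

/-- A minimal infinite tree has no leaves. -/
theorem IsMinimal.exists_adj_ne {ρ : G →* (T ≃g T)} (h : IsMinimal ρ) [Infinite V]
    (hT : T.Connected) (v : V) : ∃ a b, T.Adj v a ∧ T.Adj v b ∧ a ≠ b := by
  let U : Set V := {v | ∃ a b, T.Adj v a ∧ T.Adj v b ∧ a ≠ b}
  suffices hU : U = Set.univ from (hU ▸ Set.mem_univ v : v ∈ U)
  apply h.eq_univ
  · by_contra hne
    rw [Set.not_nonempty_iff_eq_empty] at hne
    have huniq : ∀ x a b, T.Adj x a → T.Adj x b → a = b := by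
      intro x a b ha hb
      by_contra hab
      have : x ∈ U := ⟨a, b, ha, hb, hab⟩
      simp [hne] at this
    obtain ⟨w, hvw⟩ := hT.preconnected.exists_adj_of_nontrivial v
    have key : ∀ x y, T.Walk x y → (x = v ∨ x = w) → (y = v ∨ y = w) := by
      intro x y p
      induction p with
      | nil => exact id
      | cons hadj p ih =>
        rintro (rfl | rfl)
        · exact ih (Or.inr (huniq _ _ _ hadj hvw))
        · exact ih (Or.inl (huniq _ _ _ hadj hvw.symm))
    refine Set.infinite_univ (α := V) ((Set.toFinite {v, w}).subset fun y _ => ?_)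
    exact key v y (hT.preconnected v y).some (Or.inl rfl)
  · rintro g x ⟨a, b, ha, hb, hab⟩
    exact ⟨ρ g a, ρ g b, (ρ g).map_adj_iff.2 ha, (ρ g).map_adj_iff.2 hb,
      fun h => hab ((ρ g).injective h)⟩
  -- Interior vertices of a path have two distinct neighbours on it.
  · intro x hx y hy
    obtain ⟨p, hp⟩ := hT.exists_path_of_dist x y
    replace hp := hp.1
    induction p with
    | nil => exact Joined.refl hx
    | cons hadj p ih =>
      rename_i x x' y
      have hx' : x' ∈ U := by
        cases p with
        | nil => exact hy
        | cons hadj' p =>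
          refine ⟨_, _, hadj.symm, hadj', ?_⟩
          rintro rfl
          simp [Walk.cons_isPath_iff] at hp
      exact (Joined.of_adj hadj hx hx').trans (ih hx' hy hp.of_cons)

/-- The orbit of every vertex is cobounded, if the action is cocompact. -/
theorem IsCocompact.exists_dist_le {ρ : G →* (T ≃g T)} (h : IsCocompact ρ) (a : V) :
    ∃ D, ∀ x, ∃ g, T.dist x (ρ g a) ≤ D := by
  obtain ⟨K, hK, hv, -⟩ := h
  obtain ⟨D, hD⟩ := (hK.image fun k => T.dist k a).bddAbove
  refine ⟨D, fun x => ?_⟩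
  obtain ⟨g, hg⟩ := hv x
  refine ⟨g⁻¹, ?_⟩
  rw [← dist_iso (ρ g), apply_inv_apply]
  exact hD ⟨_, hg, rfl⟩

theorem IsLocallyFinite.finite_neighborSet (h : IsLocallyFinite T) (v : V) :
    (T.neighborSet v).Finite := by
  refine Set.Finite.of_finite_image ((h v).subset ?_)
    (f := fun w => s(v, w)) (fun a _ b _ hab => Sym2.congr_right.1 hab)
  rintro _ ⟨w, hw, rfl⟩
  exact (T.mem_incidenceSet v w).2 hw

/-! ### Lifting walks, folds -/

/-- Walks lift under locally surjective morphisms. -/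
theorem LocallySurjective.exists_lift {q : T' →g T} (h : LocallySurjective q) {a z : V}
    (p : T.Walk a z) (x : W) (hx : q x = a) :
    ∃ y, q y = z ∧ Joined T' {v | q v ∈ p.support} x y := by
  induction p generalizing x with
  | nil => exact ⟨x, hx, Joined.refl (by simp [hx])⟩
  | cons hadj p ih =>
    rename_i a b z
    subst hx
    obtain ⟨e, he, hqe⟩ := h x ((T.mem_incidenceSet (q x) b).2 hadj)
    obtain ⟨x', rfl⟩ := Sym2.mem_iff_exists.1 he.2
    have hx' : q x' = b := Sym2.congr_right.1 hqe
    obtain ⟨y, hy, hj⟩ := ih x' hx'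
    refine ⟨y, hy, (Joined.of_adj ((T'.mem_incidenceSet x x').1 he) ?_ ?_).trans (hj.mono ?_)⟩
    · simp
    · simp [hx']
    · intro v hv
      exact List.mem_cons_of_mem _ hv

/-- A morphism that is not locally injective identifies two edges at some vertex. -/
theorem exists_fold_of_not_locallyInjective {q : T' →g T} (h : ¬ LocallyInjective q) :
    ∃ u a b, T'.Adj u a ∧ T'.Adj u b ∧ a ≠ b ∧ q a = q b := by
  simp only [LocallyInjective, Set.InjOn, not_forall] at h
  obtain ⟨u, e, he, e', he', hq, hne⟩ := h
  obtain ⟨a, rfl⟩ := Sym2.mem_iff_exists.1 he.2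
  obtain ⟨b, rfl⟩ := Sym2.mem_iff_exists.1 he'.2
  exact ⟨u, a, b, (T'.mem_incidenceSet u a).1 he, (T'.mem_incidenceSet u b).1 he',
    fun h => hne (by rw [h]), Sym2.congr_right.1 hq⟩

/-- A subgroup is finitely generated if it is covered by finitely many cosets of a finitely generated
subgroup of it. -/
theorem fg_of_finite_cosets {K L : Subgroup G} (hK : K.FG) (hKL : K ≤ L) {F : Set G}
    (hF : F.Finite) (hFL : F ⊆ L) (h : ∀ g ∈ L, ∃ f ∈ F, f⁻¹ * g ∈ K) : L.FG := by
  obtain ⟨S, rfl, hS⟩ := (Subgroup.fg_iff K).1 hK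
  refine (Subgroup.fg_iff L).2 ⟨S ∪ F, le_antisymm ?_ fun g hg => ?_, hS.union hF⟩
  · rw [Subgroup.closure_le]
    exact Set.union_subset ((Subgroup.closure_le L).1 hKL) hFL
  · obtain ⟨f, hf, hfg⟩ := h g hg
    rw [← mul_inv_cancel_left f g]
    exact mul_mem (Subgroup.subset_closure (Or.inr hf))
      (Subgroup.closure_mono Set.subset_union_left hfg)

/-- The two ends of the image of a fold in a half-tree at `z` lift to vertices over `z` that are only
joined through the vertex of the fold. -/
theorem exists_not_joined_of_fold (hT : T.IsTree) (hT' : T'.IsTree) {q : T' →g T}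
    (hq : LocallySurjective q) {u a b : W} (ha : T'.Adj u a) (hb : T'.Adj u b) (hab : a ≠ b)
    (hqab : q a = q b) {z : V} (hz : z ∈ T.half (q u) (q a)) :
    ∃ x y, q x = z ∧ q y = z ∧ ∀ U : Set W, Joined T' U x y → u ∈ U := by
  obtain ⟨p, hp⟩ := hT.connected.exists_walk_length_eq_dist (q a) z
  have hqu : q u ∉ p.support := by
    classical
    intro hmem
    have h1 := dist_le (p.dropUntil _ hmem)
    have h2 := p.length_dropUntil_le_length hmem
    rw [mem_half, dist_comm, dist_comm (v := q a)] at hz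
    omega
  obtain ⟨x, hx, hax⟩ := hq.exists_lift p a rfl
  obtain ⟨y, hy, hby⟩ := hq.exists_lift p b hqab.symm
  refine ⟨x, y, hx, hy, fun U hU => ?_⟩
  -- The two lifts avoid `u` because their image avoids `q u`; closed up by a walk in `U` they join
  -- `a` to `b`, so the part in `U` meets `u`.
  obtain ⟨r, hr⟩ := ((hax.mono (Set.subset_union_left (t := U))).trans
    (hU.mono Set.subset_union_right)).trans (hby.mono Set.subset_union_left).symm
  exact (hr u (hT'.mem_support_of_adj ha hb hab r)).resolve_left hqu

/-- If the domain has no leaves and there is a fold, then there is a fold with an infinite half-tree. -/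
theorem exists_fold_infinite_half [Infinite V] (hT : T.IsTree) (hT' : T'.IsTree)
    (hleaf : ∀ v, ∃ a b, T'.Adj v a ∧ T'.Adj v b ∧ a ≠ b) (q : T' →g T)
    (hfold : ∃ u a b, T'.Adj u a ∧ T'.Adj u b ∧ a ≠ b ∧ q a = q b) :
    ∃ u a b, T'.Adj u a ∧ T'.Adj u b ∧ a ≠ b ∧ q a = q b ∧ (T.half (q u) (q a)).Infinite := by
  obtain ⟨u, a, b, ha, hb, hab, hq⟩ := hfold
  by_cases hinf : (T.half (q u) (q a)).Infinite
  · exact ⟨u, a, b, ha, hb, hab, hq, hinf⟩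
  rw [Set.not_infinite] at hinf
  have hqa := q.map_adj ha
  obtain ⟨M, hM⟩ := (hinf.image fun y => T.dist (q u) y).bddAbove
  -- Depths reached over the finite half-tree without loss of distance from `u`. At a vertex `x` of
  -- non-extendable depth, the edges back and onward must fold together.
  let P : ℕ → Prop := fun n => ∃ x, q x ∈ T.half (q u) (q a) ∧
    T.dist (q u) (q x) = n ∧ T'.dist u x = n
  have hbound : ∀ n, P n → n ≤ M := by
    rintro n ⟨x, hx, rfl, -⟩
    exact hM ⟨_, hx, rfl⟩
  have hP1 : P 1 := by
    refine ⟨a, ?_, dist_eq_one_iff_adj.2 hqa, dist_eq_one_iff_adj.2 ha⟩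
    rw [mem_half, dist_self, dist_eq_one_iff_adj.2 hqa.symm]
  obtain ⟨n, ⟨x, hx, hxq, hxu⟩, hmax⟩ : ∃ n, P n ∧ ¬ P (n + 1) := by
    by_contra! hcon
    have : ∀ n, P (n + 1) := fun n => by
      induction n with
      | zero => exact hP1
      | succ n ih => exact hcon _ ih
    have := hbound _ (this M)
    omega
  have hxu' : x ≠ u := by
    rintro rfl
    exact left_notMem_half hx
  obtain ⟨x₀, hx₀, hd₀⟩ := hT'.connected.exists_adj_dist_eq hxu'
  obtain ⟨x₁, hx₁, hne⟩ : ∃ x₁, T'.Adj x x₁ ∧ x₀ ≠ x₁ := by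
    obtain ⟨c, d, hc, hd, hcd⟩ := hleaf x
    by_cases h : x₀ = c
    · exact ⟨d, hd, h ▸ hcd⟩
    · exact ⟨c, hc, h⟩
  have hd₁ : T'.dist u x₁ = n + 1 := by
    rcases hT'.dist_eq_dist_add_one_of_adj u hx₁ with h | h
    · exact absurd (hT'.eq_of_adj_of_dist hx₀ hx₁ hd₀ h) hne
    · omega
  have hq₀ := q.map_adj hx₀
  have hq₁ := q.map_adj hx₁
  have hle : ∀ y, T.dist (q u) (q y) ≤ T'.dist u y := by
    intro y
    obtain ⟨p, hp⟩ := hT'.connected.exists_walk_length_eq_dist u y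
    rw [← hp, ← Walk.length_map q p]
    exact dist_le _
  have hdq₀ : T.dist (q u) (q x) = T.dist (q u) (q x₀) + 1 := by
    have := hle x₀
    have := hT.dist_eq_dist_add_one_of_adj (q u) hq₀
    omega
  have hdq₁ : T.dist (q u) (q x) = T.dist (q u) (q x₁) + 1 := by
    rcases hT.dist_eq_dist_add_one_of_adj (q u) hq₁ with h | h
    · exact h
    · refine absurd ⟨x₁, ?_, by omega, hd₁⟩ hmax
      have h1 := hT.dist_eq_dist_add_one_of_adj (q x₁) hqa
      have h2 := hT.connected.dist_triangle (u := q x₁) (v := q x) (w := q a)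
      have h3 : T.dist (q x₁) (q x) = 1 := dist_eq_one_iff_adj.2 hq₁.symm
      have h4 := dist_comm (G := T) (u := q x₁) (v := q u)
      have h5 := dist_comm (G := T) (u := q x) (v := q u)
      rw [mem_half] at hx ⊢
      omega
  -- The new fold points back to `q u`, so its half-tree contains the complement of the finite one.
  refine ⟨x, x₀, x₁, hx₀, hx₁, hne, hT.eq_of_adj_of_dist hq₀ hq₁ hdq₀ hdq₁,
    (Set.Finite.infinite_compl hinf).mono fun y hy => ?_⟩
  have h1 := hT.dist_eq_of_half hqa hy hx
  have h2 := hT.connected.dist_triangle (u := y) (v := q u) (w := q x₀)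
  have h3 := hT.dist_eq_dist_add_one_of_adj y hq₀
  rw [mem_half]
  omega

/-! ### Vertex stabilizers -/

/-- The stabilizer of a vertex. -/
def vertexStabilizer (ρ : G →* (T ≃g T)) (v : V) : Subgroup G :=
  (MulAction.stabilizer (T ≃g T) v).comap ρ

theorem mem_vertexStabilizer {ρ : G →* (T ≃g T)} {v : V} {g : G} :
    g ∈ vertexStabilizer ρ v ↔ ρ g v = v := Iff.rfl

/-- If the stabilizer of `z` is finitely generated, then all vertices over `z` lie in one component of the
preimage of some ball about `z`. -/
theorem exists_joined_of_fg {ρ : G →* (T ≃g T)} {ρ' : G →* (T' ≃g T')} {q : T' →g T}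
    (hG : Group.FG G) (hT' : T'.Connected) (hmin : IsMinimal ρ') (hq : IsEquivariant ρ' ρ q) {z : V}
    (hz : (vertexStabilizer ρ z).FG) :
    ∃ R, ∀ x y, q x = z → q y = z → Joined T' {v | T.dist z (q v) ≤ R} x y := by
  obtain ⟨F, hF, hFT⟩ := hmin.exists_finite hG hT'
  obtain ⟨S, hS⟩ := hz
  by_cases hex : ∃ x, q x = z
  swap
  · exact ⟨0, fun x _ hx => absurd ⟨x, hx⟩ hex⟩
  obtain ⟨x, hx⟩ := hex
  let A : Set W := (fun s => ρ' s x) '' (S : Set G)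
  -- One point of the fibre is chosen in each orbit meeting it; `f` itself is a dummy value
  -- otherwise.
  have hrep : ∀ f, ∃ y, (∃ g, q (ρ' g f) = z) → q y = z ∧ ∃ g, ρ' g f = y := fun f => by
    by_cases h : ∃ g, q (ρ' g f) = z
    · obtain ⟨g, hg⟩ := h
      exact ⟨ρ' g f, fun _ => ⟨hg, g, rfl⟩⟩
    · exact ⟨f, fun h' => absurd h' h⟩
  choose r hr using hrep
  have hfin : (A ∪ r '' F).Finite := (S.finite_toSet.image _).union (hF.image r)
  let p : ∀ y, T'.Walk x y := fun y => (hT'.preconnected x y).some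
  have hfin' : (⋃ y ∈ A ∪ r '' F, {v | v ∈ (p y).support}).Finite :=
    hfin.biUnion fun y _ => List.finite_toSet _
  obtain ⟨R, hR⟩ := (hfin'.image fun v => T.dist z (q v)).bddAbove
  refine ⟨R, ?_⟩
  set U : Set W := {v | T.dist z (q v) ≤ R} with hUdef
  have hjoin : ∀ y ∈ A ∪ r '' F, Joined T' U x y := fun y hy =>
    ⟨p y, fun v hv => hR ⟨v, Set.mem_biUnion hy hv, rfl⟩⟩
  have hU : ∀ g ∈ vertexStabilizer ρ z, ∀ v ∈ U, ρ' g v ∈ U := by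
    intro g hg v hv
    rw [mem_vertexStabilizer] at hg
    change T.dist z (q (ρ' g v)) ≤ R
    rw [hq, ← hg, dist_iso]
    exact hv
  have hxU : x ∈ U := by simp [hUdef, hx]
  have key : ∀ y, q y = z → Joined T' U x y := by
    intro y hy
    obtain ⟨g, f, hf, rfl⟩ := hFT y
    obtain ⟨hrz, k, hk⟩ := hr f ⟨g, hy⟩
    have hmem : g * k⁻¹ ∈ vertexStabilizer ρ z := by
      rw [mem_vertexStabilizer]
      conv_lhs => rw [← hrz]
      rw [← hk, ← hq, map_mul, RelIso.mul_apply, inv_apply_apply, hy]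
    have h1 : Joined T' U x (ρ' (g * k⁻¹) x) :=
      joined_of_mem_closure (S := (S : Set G)) ρ' hxU (hS.symm ▸ hU)
        (fun s hs => hjoin _ (Or.inl ⟨s, hs, rfl⟩)) (hS.symm ▸ hmem)
    have h2 := (hjoin (r f) (Or.inr ⟨f, hf, rfl⟩)).map (ρ' (g * k⁻¹)) (hU _ hmem)
    rw [← hk, map_mul, RelIso.mul_apply, RelIso.mul_apply, inv_apply_apply] at h2
    rw [map_mul, RelIso.mul_apply] at h1
    exact h1.trans h2
  exact fun y y' hy hy' => (key y hy).symm.trans (key y' hy')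

theorem CollapsingConditions.not_fg_vertexStabilizer {ρ : G →* (T ≃g T)} {ρ' : G →* (T' ≃g T')}
    {q : T' →g T} (h : CollapsingConditions ρ ρ' q) (z : V) : ¬ (vertexStabilizer ρ z).FG := by
  intro hz
  have hT := h.isGTree.isTree
  have hT' := h.isGTree'.isTree
  have := h.isGTree.infinite
  have := h.isGTree'.infinite
  obtain ⟨R, hR⟩ := exists_joined_of_fg h.fg hT'.connected h.minimal' h.equivariant hz
  obtain ⟨u, a, b, ha, hb, hab, hqab, hinf⟩ := exists_fold_infinite_half hT hT'
    (h.minimal'.exists_adj_ne hT'.connected) q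
    (exists_fold_of_not_locallyInjective h.not_locallyInjective)
  obtain ⟨D, hD⟩ := h.cocompact.exists_dist_le (q u)
  obtain ⟨g, hg, hgz⟩ := hT.exists_mem_half_of_infinite h.locallyFinite.finite_neighborSet ρ
    (q.map_adj ha) hinf hD z R
  rw [← h.equivariant, ← h.equivariant] at hgz
  obtain ⟨x, y, hx, hy, hxy⟩ := exists_not_joined_of_fold hT hT' h.locallySurjective
    ((ρ' g).map_adj_iff.2 ha) ((ρ' g).map_adj_iff.2 hb) (fun h => hab ((ρ' g).injective h))
    (by rw [h.equivariant, h.equivariant, hqab]) hgz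
  have : T.dist z (q (ρ' g u)) ≤ R := hxy _ (hR x y hx hy)
  rw [h.equivariant] at this
  omega

/-! ### From vertices to points of the realization -/

theorem mem_pointStabilizer {ρ : G →* (T ≃g T)} {z : Realization T} {g : G} :
    g ∈ pointStabilizer ρ z ↔ Finsupp.mapDomain (ρ g) z.1 = z.1 :=
  Subtype.ext_iff

/-- For an action without inversions, the stabilizer of a point is the stabilizer of an edge or of a
vertex. -/
theorem exists_pointStabilizer_eq {ρ : G →* (T ≃g T)}
    (h : ∀ (g : G) (u v : V), T.Adj u v → ¬ (ρ g u = v ∧ ρ g v = u)) (z : Realization T) :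
    ∃ u v, (u = v ∨ T.Adj u v) ∧
      pointStabilizer ρ z = vertexStabilizer ρ u ⊓ vertexStabilizer ρ v := by
  obtain ⟨u, v, huv, s, t, hs, ht, hst, hz⟩ := z.2
  have hvert : ∀ w, z.1 = Finsupp.single w 1 →
      pointStabilizer ρ z = vertexStabilizer ρ w ⊓ vertexStabilizer ρ w := by
    intro w hw
    ext g
    rw [mem_pointStabilizer, inf_idem, mem_vertexStabilizer, hw, Finsupp.mapDomain_single]
    exact Finsupp.single_left_inj one_ne_zero
  rcases huv with rfl | huv
  · exact ⟨u, u, Or.inl rfl, hvert u (by rw [← hz, ← add_smul, hst, one_smul])⟩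
  by_cases hs0 : s = 0
  · refine ⟨v, v, Or.inl rfl, hvert v ?_⟩
    have : t = 1 := by linarith
    rw [← hz, hs0, this, zero_smul, zero_add, one_smul]
  by_cases ht0 : t = 0
  · refine ⟨u, u, Or.inl rfl, hvert u ?_⟩
    have : s = 1 := by linarith
    rw [← hz, ht0, this, zero_smul, add_zero, one_smul]
  refine ⟨u, v, Or.inr huv, ?_⟩
  ext g
  rw [mem_pointStabilizer, Subgroup.mem_inf, mem_vertexStabilizer, mem_vertexStabilizer]
  constructor
  · intro hg
    -- An element fixing `z` permutes its support, the two ends of the edge; a swap would be an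
    -- inversion.
    have hval : ∀ w, z.1 w ≠ 0 → w = u ∨ w = v := by
      intro w hw
      by_contra! hne
      apply hw
      rw [← hz]
      simp [hne.1.symm, hne.2.symm]
    have hzg : ∀ w, z.1 (ρ g w) = z.1 w := fun w => by
      conv_lhs => rw [← hg]
      exact Finsupp.mapDomain_apply (ρ g).injective _ _
    have hzu : z.1 u ≠ 0 := by
      rw [← hz]
      simpa [Finsupp.single_apply, huv.ne'] using hs0
    have hzv : z.1 v ≠ 0 := by
      rw [← hz]
      simpa [Finsupp.single_apply, huv.ne] using ht0
    have hgu := hval (ρ g u) (by rwa [hzg])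
    have hgv := hval (ρ g v) (by rwa [hzg])
    have hne : ρ g u ≠ ρ g v := fun h => huv.ne ((ρ g).injective h)
    rcases hgu with hgu | hgu
    · exact ⟨hgu, hgv.resolve_left fun h => hne (hgu.trans h.symm)⟩
    · exact absurd ⟨hgu, hgv.resolve_right fun h => hne (hgu.trans h.symm)⟩ (h g u v huv)
  · rintro ⟨hgu, hgv⟩
    rw [← hz]
    simp [Finsupp.mapDomain_add, Finsupp.mapDomain_single, hgu, hgv]

/-- In a locally finite graph, stabilizers of edges have finite index in stabilizers of their ends. -/
theorem fg_vertexStabilizer_of_fg_inf {ρ : G →* (T ≃g T)} {u v : V}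
    (hf : (T.neighborSet u).Finite) (huv : u = v ∨ T.Adj u v)
    (hfg : (vertexStabilizer ρ u ⊓ vertexStabilizer ρ v).FG) : (vertexStabilizer ρ u).FG := by
  rcases huv with rfl | huv
  · rwa [inf_idem] at hfg
  -- This orbit lies in the finite star of `u` and parametrizes the cosets of the edge stabilizer.
  let N : Set V := {w | ∃ g ∈ vertexStabilizer ρ u, ρ g v = w}
  have hN : N.Finite := hf.subset (by
    rintro _ ⟨g, hg, rfl⟩
    have := (ρ g).map_adj_iff.2 huv
    rwa [mem_vertexStabilizer.1 hg] at this)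
  have hrep : ∀ w, ∃ g, w ∈ N → g ∈ vertexStabilizer ρ u ∧ ρ g v = w := fun w => by
    by_cases h : w ∈ N
    · obtain ⟨g, hg⟩ := h
      exact ⟨g, fun _ => hg⟩
    · exact ⟨1, fun h' => absurd h' h⟩
  choose r hr using hrep
  refine fg_of_finite_cosets hfg inf_le_left (hN.image r) ?_ fun g hg => ?_
  · rintro _ ⟨w, hw, rfl⟩
    exact (hr w hw).1
  · have hw : ρ g v ∈ N := ⟨g, hg, rfl⟩
    refine ⟨r (ρ g v), ⟨_, hw, rfl⟩,
      Subgroup.mem_inf.2 ⟨mul_mem (inv_mem (hr _ hw).1) hg, ?_⟩⟩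
    rw [mem_vertexStabilizer, map_mul, RelIso.mul_apply]
    exact (congrArg _ (hr _ hw).2.symm).trans (inv_apply_apply _ _ _)

end TreeAction

theorem corollary1p5 {G : Type*} [Group G] {V : Type*} {T : SimpleGraph V}
    (ρ : G →* (T ≃g T))
    (h : ∃ (W : Type*) (T' : SimpleGraph W) (ρ' : G →* (T' ≃g T')) (q : T' →g T),
      TreeAction.CollapsingConditions ρ ρ' q)
    (z : TreeAction.Realization T) :
    ¬ (TreeAction.pointStabilizer ρ z).FG := by
  obtain ⟨W, T', ρ', q, h⟩ := h
  obtain ⟨u, v, huv, hz⟩ := TreeAction.exists_pointStabilizer_eq h.isGTree.no_inversion z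
  rw [hz]
  exact fun hfg => h.not_fg_vertexStabilizer u
    (TreeAction.fg_vertexStabilizer_of_fg_inf (h.locallyFinite.finite_neighborSet u) huv hfg)
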